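/- Let $X\in\mathbb R^{n\times p}$ and let $\eta\mapsto l(\eta;y)$ be a differentiable real-valued loss on $\mathbb R^n$, for each value $y$ of the (random) response. Let $\beta^*\in\mathbb R^p$, $\gamma^*\in\mathbb R^n$, let $\|\cdot\|_0$ count nonzero entries, and put $s^*=\|\beta^*\|_0$, $o^*=\|\gamma^*\|_0$. Write $\bar X\bar\beta = X\beta+\gamma$ for $\bar\beta=(\beta,\gamma)$, $\Delta_l(a,b)=l(a)-l(b)-\langle\nabla l(b),a-b\rangle$ and $D_2(a,b)=\tfrac12\|a-b\|_2^2$ (the dependence of $l$ on $y$ being suppressed). Assume that the effective noise $\epsilon=-\nabla l(\bar X\bar\beta^*)$ is sub-Gaussian with mean zero and scale bounded by $\sigma\ge 0$: for every $a\in\mathbb R^n$ the variable $\langle\epsilon,a\rangle$ is sub-Gaussian with mean zero and $\inf\{s>0:\mathbb E\exp(\langle\epsilon,a\rangle^2/s^2)\le 2\}\le\sigma\|a\|_2$. Let $\vartheta\ge 1$ be such that $q_\beta=\vartheta s^*$ and $q_\gamma=\vartheta o^*$ are integers, and let $\hat{\bar\beta}=(\hat\beta,\hat\gamma)$ be any (measurable)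 global minimizer of $l(X\beta+\gamma;y)$ over all $(\beta,\gamma)$ with $\|\beta\|_0\le q_\beta$, $\|\gamma\|_0\le q_\gamma$. Assume that for some $\delta>0$, almost surely, $$(\Delta_l-\delta D_2)(\bar X\bar\beta,\bar X\bar\beta')\ge 0$$ for all $\bar\beta=(\beta,\gamma)$, $\bar\beta'=(\beta',\gamma')$ with $\|\beta\|_0\le\vartheta s^*$, $\|\beta'\|_0\le s^*$, $\|\gamma\|_0\le\vartheta o^*$, $\|\gamma'\|_0\le o^*$. Then, with a universal constant $C>0$, $$\mathbb E\big[D_2(\bar X\hat{\bar\beta},\bar X\bar\beta^*)\big]\le C\Big\{\frac{\vartheta}{\delta^2}\sigma^2\Big(s^*\log\frac{ep}{s^*}+o^*\log\frac{en}{o^*}\Big)+\frac{\sigma^2}{\delta^2}\Big\},$$ where $0\log(\cdot/0)=0$; in particular the expectation is finite. Moreover, the displayed condition holds with $\delta=m$ whenever $l$ is differentiable and $m$-strongly convex in $\eta$ with $m>0$, for every design $X$ and all sparsity levels; for the squared error loss $l(\eta;y)=\tfrac12\|\eta-y\|_2^2$ it holds with $\delta=1$. -/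

import Mathlib

open MeasureTheory
open scoped ENNReal Matrix

noncomputable section

namespace ResistantLearning

/-- The number of nonzero coordinates of a vector. -/
def l0norm {m : ℕ} (v : EuclideanSpace ℝ (Fin m)) : ℕ :=
  hammingNorm v.ofLp

/-- The systematic component `X β + γ`, that is, the concatenated design `[X I]` applied to the
concatenated coefficient vector `[β; γ]`. -/
def sysComp {n p : ℕ} (X : Matrix (Fin n) (Fin p) ℝ)
    (b : EuclideanSpace ℝ (Fin p)) (g : EuclideanSpace ℝ (Fin n)) :
    EuclideanSpace ℝ (Fin n) :=
  WithLp.toLp 2 (X *ᵥ b.ofLp) + g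

/-- The generalized Bregman function `Δ_f(a, b) = f(a) - f(b) - ⟨∇f(b), a - b⟩` of a
differentiable function `f`. -/
def gbf {n : ℕ} (f : EuclideanSpace ℝ (Fin n) → ℝ) (a b : EuclideanSpace ℝ (Fin n)) : ℝ :=
  f a - f b - inner ℝ (gradient f b) (a - b)

/-- `D₂(a, b) = ‖a - b‖² / 2`. -/
def D2 {n : ℕ} (a b : EuclideanSpace ℝ (Fin n)) : ℝ :=
  ‖a - b‖ ^ 2 / 2

/-- The effective noise `-∇f(η)` of the loss `f` at the true systematic component `η`. -/
def effNoise {n : ℕ} (f : EuclideanSpace ℝ (Fin n) → ℝ) (η : EuclideanSpace ℝ (Fin n)) :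
    EuclideanSpace ℝ (Fin n) :=
  -gradient f η

/-- The `ψ₂`-norm `inf {s > 0 : E exp(ξ²/s²) ≤ 2}`, with value `∞` if there is no such `s`. -/
def psi2Norm {Ω : Type*} [MeasurableSpace Ω] (μ : Measure Ω) (ξ : Ω → ℝ) : ℝ≥0∞ :=
  ⨅ (s : ℝ) (_ : 0 < s)
    (_ : ∫⁻ ω, ENNReal.ofReal (Real.exp (ξ ω ^ 2 / s ^ 2)) ∂μ ≤ 2), ENNReal.ofReal s

/-- Sub-Gaussian random variables: mean zero and Gaussian tails. -/
def IsSubGaussian {Ω : Type*} [MeasurableSpace Ω] (μ : Measure Ω) (ξ : Ω → ℝ) : Prop :=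
  Integrable ξ μ ∧ ∫ ω, ξ ω ∂μ = 0 ∧
    ∃ C > 0, ∃ c > 0, ∀ t : ℝ, 0 < t →
      μ {ω | t ≤ |ξ ω|} ≤ ENNReal.ofReal (C * Real.exp (-c * t ^ 2))

/-- Sub-Gaussian random vectors with mean zero and scale bounded by `σ`: every one-dimensional
marginal `⟨ξ, a⟩` is sub-Gaussian with `ψ₂`-norm at most `σ ‖a‖`. -/
def IsSubGaussianVec {Ω : Type*} [MeasurableSpace Ω] (μ : Measure Ω) {n : ℕ}
    (ξ : Ω → EuclideanSpace ℝ (Fin n)) (σ : ℝ) : Prop :=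
  ∀ a : EuclideanSpace ℝ (Fin n),
    IsSubGaussian μ (fun ω => inner ℝ (ξ ω) a) ∧
      psi2Norm μ (fun ω => inner ℝ (ξ ω) a) ≤ ENNReal.ofReal (σ * ‖a‖)

/-- The feasible set `{(β, γ) : ‖β‖₀ ≤ qβ, ‖γ‖₀ ≤ qγ}` of the doubly constrained problem. -/
def feasible (p n qβ qγ : ℕ) :
    Set (EuclideanSpace ℝ (Fin p) × EuclideanSpace ℝ (Fin n)) :=
  {z | l0norm z.1 ≤ qβ ∧ l0norm z.2 ≤ qγ}

/-- `(b, g)` is a global minimizer of `f(X β + γ)` subject to `‖β‖₀ ≤ qβ` and `‖γ‖₀ ≤ qγ`. -/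
def IsGlobalMinimizer {n p : ℕ} (X : Matrix (Fin n) (Fin p) ℝ)
    (f : EuclideanSpace ℝ (Fin n) → ℝ) (qβ qγ : ℕ)
    (b : EuclideanSpace ℝ (Fin p)) (g : EuclideanSpace ℝ (Fin n)) : Prop :=
  (b, g) ∈ feasible p n qβ qγ ∧
    IsMinOn (fun z => f (sysComp X z.1 z.2)) (feasible p n qβ qγ) (b, g)

/-- The regularity condition `(Δ_f - δ D₂)(X β + γ, X β' + γ') ≥ 0` for all sparse pairs with
`‖β‖₀ ≤ ϑ s`, `‖β'‖₀ ≤ s`, `‖γ‖₀ ≤ ϑ o`, `‖γ'‖₀ ≤ o`. -/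
def RegCond {n p : ℕ} (X : Matrix (Fin n) (Fin p) ℝ)
    (f : EuclideanSpace ℝ (Fin n) → ℝ) (s o : ℕ) (ϑ δ : ℝ) : Prop :=
  ∀ (b b' : EuclideanSpace ℝ (Fin p)) (g g' : EuclideanSpace ℝ (Fin n)),
    (l0norm b : ℝ) ≤ ϑ * s → l0norm b' ≤ s →
    (l0norm g : ℝ) ≤ ϑ * o → l0norm g' ≤ o →
    0 ≤ gbf f (sysComp X b g) (sysComp X b' g') - δ * D2 (sysComp X b g) (sysComp X b' g')

/-- The complexity `s log(e p / s) + o log(e n / o)`, with `0 log(·/0) = 0`. -/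
def complexity (p n s o : ℕ) : ℝ :=
  s * Real.log (Real.exp 1 * p / s) + o * Real.log (Real.exp 1 * n / o)

end ResistantLearning

end

namespace ResistantLearning

/-! Since ϑ ≥ 1 the truth is feasible, so minimality and regularity give δ D₂ ≤ ⟨ε, w⟩, where w is
the error in the systematic component (`IsGlobalMinimizer.mul_D2_le_inner`). As w lies in the span V
of the columns indexed by the supports of estimate and truth, D₂ ≤ 2δ⁻²‖P_V ε‖²
(`half_sq_norm_le_of_mem`). V is random but ranges over finitely many subspaces. For each fixed one
and any κ > σ, integrating the exponential moments of ε against a Gaussian weight gives E exp(‖P_V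
ε‖²/(2κ²)) ≤ 2·2^(dim V/2) (`lintegral_exp_sq_norm_le`). Multiplied by the number of subspaces, the
dimension-uniform bound is at most e^A with A = 2ϑQ + 1, Q the complexity
(`card_supportPairs_mul_le`). Then x ≤ A + e^(x-A), summed over all subspaces, yields E D₂ ≤
4κ²δ⁻²(A + 1), and κ ↓ σ concludes. For strongly convex losses, regularity is the tangent inequality
for f - (m/2)‖·‖² along a line. -/

/-! ### Counting supports -/

open Finset in
/-- The number of subsets of `Fin p` with at most `q` elements is at most `(e p / s) ^ q`
for `s ≤ q`. -/
lemma card_filter_card_le {p s q : ℕ} (hsp : s ≤ p) (hsq : s ≤ q) (h0 : s = 0 → q = 0) :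
    ((univ.filter fun T : Finset (Fin p) => #T ≤ q).card : ℝ) ≤
      Real.exp (q * Real.log (Real.exp 1 * p / s)) := by
  rcases Nat.eq_zero_or_pos s with hs | hs
  -- With s = 0, division by zero and log 0 = 0 make the right side 1, so only the empty set may be
  -- counted.
  · have hq := h0 hs
    subst hq
    simp [Finset.filter_eq']
  have hs' : (0 : ℝ) < s := by exact_mod_cast hs
  have hp' : (0 : ℝ) < p := by exact_mod_cast hs.trans_le hsp
  have hsq' : (s : ℝ) ≤ q := by exact_mod_cast hsq
  have hx1 : (s / p : ℝ) ≤ 1 := by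
    rw [div_le_one hp']
    exact_mod_cast hsp
  have hx0 : (0 : ℝ) < s / p := by positivity
  have hexp : Real.exp (q * Real.log (Real.exp 1 * p / s)) =
      (Real.exp 1) ^ q * ((s / p : ℝ) ^ q)⁻¹ := by
    rw [mul_comm, Real.exp_mul, Real.exp_log (by positivity), Real.rpow_natCast, ← inv_pow,
      ← mul_pow, inv_div, mul_div_assoc]
  rw [hexp, ← div_eq_mul_inv, le_div_iff₀ (by positivity)]
  -- Chernoff-type count: weight T by x ^ #T with x = s/p ≤ 1; over all subsets the weights sum to
  -- (1 + x)^p ≤ e^s.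
  calc ((univ.filter fun T : Finset (Fin p) => #T ≤ q).card : ℝ) * (s / p : ℝ) ^ q
      = ∑ T ∈ univ.filter (fun T : Finset (Fin p) => #T ≤ q), (s / p : ℝ) ^ q := by
        rw [sum_const, nsmul_eq_mul]
    _ ≤ ∑ T ∈ univ.filter (fun T : Finset (Fin p) => #T ≤ q), (s / p : ℝ) ^ #T := by
        refine sum_le_sum fun T hT => ?_
        exact pow_le_pow_of_le_one hx0.le hx1 (mem_filter.1 hT).2
    _ ≤ ∑ T : Finset (Fin p), (s / p : ℝ) ^ #T :=
        sum_le_sum_of_subset_of_nonneg (filter_subset _ _) fun _ _ _ => by positivity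
    _ = (s / p + 1 : ℝ) ^ p := by
        simpa using Fintype.sum_pow_mul_eq_add_pow (Fin p) (s / p : ℝ) 1
    _ ≤ Real.exp (s / p) ^ p := by
        gcongr
        exact Real.add_one_le_exp _
    _ = Real.exp s := by
        rw [← Real.exp_nat_mul]
        congr 1
        field_simp
    _ ≤ Real.exp 1 ^ q := by
        rw [← Real.exp_nat_mul, mul_one]
        exact Real.exp_le_exp.2 hsq'

/-- Because log(ep/s) = 1 + log(p/s) ≥ 1 for 0 < s ≤ p. It lets dimension terms be absorbed into the
complexity. -/
lemma natCast_le_mul_log {p s : ℕ} (hsp : s ≤ p) :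
    (s : ℝ) ≤ s * Real.log (Real.exp 1 * p / s) := by
  rcases Nat.eq_zero_or_pos s with hs | hs
  · simp [hs]
  have hs' : (0 : ℝ) < s := by exact_mod_cast hs
  have hsp' : (s : ℝ) ≤ p := by exact_mod_cast hsp
  refine le_mul_of_one_le_right hs'.le ?_
  rw [Real.le_log_iff_exp_le (by have := hs'.trans_le hsp'; positivity), mul_div_assoc]
  refine le_mul_of_one_le_right (Real.exp_pos _).le ?_
  rwa [one_le_div hs']

/-! ### Exponential moments of squared norms -/

section Gaussian

variable {V : Type*} [NormedAddCommGroup V] [InnerProductSpace ℝ V] [FiniteDimensional ℝ V]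
  [MeasurableSpace V] [BorelSpace V]

lemma lintegral_exp_neg_mul_sq_norm_add_inner {b : ℝ} (hb : 0 < b) (w : V) :
    ∫⁻ v : V, ENNReal.ofReal (Real.exp (-b * ‖v‖ ^ 2 + inner ℝ w v)) =
      ENNReal.ofReal ((Real.pi / b) ^ (Module.finrank ℝ V / 2 : ℝ) *
        Real.exp (‖w‖ ^ 2 / (4 * b))) := by
  have hI := GaussianFourier.integrable_cexp_neg_mul_sq_norm_add
    (show 0 < (b : ℂ).re from hb) 1 w
  have hE := GaussianFourier.integral_cexp_neg_mul_sq_norm_add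
    (show 0 < (b : ℂ).re from hb) 1 w
  have hcast : ∀ v : V, Complex.exp (-(b : ℂ) * ‖v‖ ^ 2 + 1 * (inner ℝ w v : ℝ)) =
      ((Real.exp (-b * ‖v‖ ^ 2 + inner ℝ w v) : ℝ) : ℂ) := fun v => by
    push_cast
    rw [one_mul]
  simp_rw [hcast] at hI hE
  have hI' : Integrable (fun v : V => Real.exp (-b * ‖v‖ ^ 2 + inner ℝ w v)) := by
    exact hI.re
  rw [← ofReal_integral_eq_lintegral_ofReal hI' (Filter.Eventually.of_forall fun v =>
    (Real.exp_pos _).le)]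
  congr 1
  rw [integral_complex_ofReal] at hE
  apply Complex.ofReal_injective
  rw [hE, Complex.ofReal_mul, Complex.ofReal_cpow (by positivity)]
  push_cast
  simp

/-- Exponential moments of the squared norm of a random vector with sub-Gaussian
exponential moments. -/
lemma lintegral_exp_sq_norm_le {Ω : Type*} [MeasurableSpace Ω] {μ : Measure Ω} [SFinite μ]
    {W : Ω → V} (hW : AEMeasurable W μ) {κ : ℝ} (hκ : 0 < κ)
    (hexp : ∀ v : V, ∫⁻ ω, ENNReal.ofReal (Real.exp (inner ℝ (W ω) v)) ∂μ ≤
      ENNReal.ofReal (2 * Real.exp (κ ^ 2 * ‖v‖ ^ 2 / 4))) :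
    ∫⁻ ω, ENNReal.ofReal (Real.exp (‖W ω‖ ^ 2 / (2 * κ ^ 2))) ∂μ ≤
      ENNReal.ofReal (2 * 2 ^ (Module.finrank ℝ V / 2 : ℝ)) := by
  set d : ℝ := Module.finrank ℝ V / 2
  have hb : 0 < κ ^ 2 / 2 := by positivity
  have hb' : 0 < κ ^ 2 / 4 := by positivity
  set c : ℝ := (Real.pi / (κ ^ 2 / 2)) ^ d with hc
  have hc0 : 0 < c := by positivity
  have hmeas : AEMeasurable (Function.uncurry fun (ω : Ω) (v : V) =>
      ENNReal.ofReal (Real.exp (-(κ ^ 2 / 2) * ‖v‖ ^ 2 + inner ℝ (W ω) v)))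
      (μ.prod volume) := by
    have h1 : AEMeasurable (fun z : Ω × V => W z.1) (μ.prod volume) :=
      hW.comp_quasiMeasurePreserving Measure.quasiMeasurePreserving_fst
    have h2 : AEMeasurable (fun z : Ω × V => z.2) (μ.prod volume) :=
      measurable_snd.aemeasurable
    exact (Real.measurable_exp.comp_aemeasurable
      (((h2.norm.pow_const 2).const_mul _).add (h1.inner h2))).ennreal_ofReal
  -- With b = κ²/2 the Gaussian integral of exp⟨W, v⟩ is c·exp(‖W‖²/(2κ²)). After Tonelli, the
  -- hypothesis costs κ²/4 in the exponent; halving b multiplies the normalising constant by 2^d.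
  have key : ENNReal.ofReal c *
      ∫⁻ ω, ENNReal.ofReal (Real.exp (‖W ω‖ ^ 2 / (2 * κ ^ 2))) ∂μ ≤
      ENNReal.ofReal c * ENNReal.ofReal (2 * 2 ^ d) := by
    calc ENNReal.ofReal c * ∫⁻ ω, ENNReal.ofReal (Real.exp (‖W ω‖ ^ 2 / (2 * κ ^ 2))) ∂μ
        = ∫⁻ ω, (∫⁻ v : V, ENNReal.ofReal
            (Real.exp (-(κ ^ 2 / 2) * ‖v‖ ^ 2 + inner ℝ (W ω) v))) ∂μ := by
          rw [← lintegral_const_mul' _ _ ENNReal.ofReal_ne_top]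
          refine lintegral_congr fun ω => ?_
          rw [lintegral_exp_neg_mul_sq_norm_add_inner hb, ← ENNReal.ofReal_mul hc0.le]
          congr 4
          ring
      _ = ∫⁻ v : V, ∫⁻ ω, ENNReal.ofReal
            (Real.exp (-(κ ^ 2 / 2) * ‖v‖ ^ 2 + inner ℝ (W ω) v)) ∂μ :=
          lintegral_lintegral_swap hmeas
      _ ≤ ∫⁻ v : V, ENNReal.ofReal 2 * ENNReal.ofReal
            (Real.exp (-(κ ^ 2 / 4) * ‖v‖ ^ 2 + inner ℝ (0 : V) v)) := by
          refine lintegral_mono fun v => ?_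
          simp_rw [Real.exp_add, ENNReal.ofReal_mul (Real.exp_pos _).le]
          rw [lintegral_const_mul' _ _ ENNReal.ofReal_ne_top]
          refine (mul_le_mul_right (hexp v) _).trans_eq ?_
          rw [← ENNReal.ofReal_mul (Real.exp_pos _).le, ← ENNReal.ofReal_mul (Real.exp_pos _).le,
            ← ENNReal.ofReal_mul zero_le_two, mul_left_comm, ← Real.exp_add, ← Real.exp_add]
          congr 3
          rw [inner_zero_left]
          ring
      _ = ENNReal.ofReal c * ENNReal.ofReal (2 * 2 ^ d) := by
          rw [lintegral_const_mul' _ _ ENNReal.ofReal_ne_top,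
            lintegral_exp_neg_mul_sq_norm_add_inner hb', ← ENNReal.ofReal_mul zero_le_two,
            ← ENNReal.ofReal_mul hc0.le]
          congr 1
          have : Real.pi / (κ ^ 2 / 4) = Real.pi / (κ ^ 2 / 2) * 2 := by
            field_simp
            norm_num
          rw [this, Real.mul_rpow (by positivity) zero_le_two]
          simp [hc, d]
          ring
  exact (ENNReal.mul_le_mul_iff_right (ENNReal.ofReal_pos.2 hc0).ne' ENNReal.ofReal_ne_top).1 key

end Gaussian

/-! ### Sub-Gaussian moment generating functions -/

/-- Gaussian moment generating function bound from a bound on the `ψ₂`-norm. -/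
lemma lintegral_exp_le_of_psi2Norm_lt {Ω : Type*} [MeasurableSpace Ω] {μ : Measure Ω}
    {ξ : Ω → ℝ} {s : ℝ} (h : psi2Norm μ ξ < ENNReal.ofReal s) :
    ∫⁻ ω, ENNReal.ofReal (Real.exp (ξ ω)) ∂μ ≤ ENNReal.ofReal (2 * Real.exp (s ^ 2 / 4)) := by
  simp only [psi2Norm, iInf_lt_iff] at h
  obtain ⟨t, ht, hle, hts⟩ := h
  have hts' : t < s := (ENNReal.ofReal_lt_ofReal_iff_of_nonneg ht.le).1 hts
  have hs : 0 < s := ht.trans hts'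
  -- AM-GM: ξ = 2·(t/2)·(ξ/t) ≤ t²/4 + ξ²/t².
  calc ∫⁻ ω, ENNReal.ofReal (Real.exp (ξ ω)) ∂μ
      ≤ ∫⁻ ω, ENNReal.ofReal (Real.exp (s ^ 2 / 4)) *
          ENNReal.ofReal (Real.exp (ξ ω ^ 2 / t ^ 2)) ∂μ := by
        refine lintegral_mono fun ω => ?_
        rw [← ENNReal.ofReal_mul (Real.exp_pos _).le, ← Real.exp_add]
        refine ENNReal.ofReal_le_ofReal (Real.exp_le_exp.2 ?_)
        have h1 : t ^ 2 / 4 ≤ s ^ 2 / 4 := by gcongr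
        have h2 : ξ ω = 2 * (t / 2) * (ξ ω / t) := by field_simp
        have h3 : t ^ 2 / 4 + ξ ω ^ 2 / t ^ 2 - 2 * (t / 2) * (ξ ω / t) =
          (t / 2 - ξ ω / t) ^ 2 := by ring
        nlinarith [sq_nonneg (t / 2 - ξ ω / t)]
    _ ≤ ENNReal.ofReal (Real.exp (s ^ 2 / 4)) * 2 := by
        rw [lintegral_const_mul' _ _ ENNReal.ofReal_ne_top]
        gcongr
    _ = ENNReal.ofReal (2 * Real.exp (s ^ 2 / 4)) := by
        rw [mul_comm, ENNReal.ofReal_mul zero_le_two, ENNReal.ofReal_ofNat]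

/-- The strict κ > σ gives room below the infimum defining the ψ₂-norm, which need not be attained;
it also covers σ = 0. -/
lemma IsSubGaussianVec.lintegral_exp_inner_le {Ω : Type*} [MeasurableSpace Ω] {μ : Measure Ω}
    [IsProbabilityMeasure μ] {n : ℕ} {ξ : Ω → EuclideanSpace ℝ (Fin n)} {σ κ : ℝ}
    (h : IsSubGaussianVec μ ξ σ) (hσ : 0 ≤ σ) (hκ : σ < κ) (a : EuclideanSpace ℝ (Fin n)) :
    ∫⁻ ω, ENNReal.ofReal (Real.exp (inner ℝ (ξ ω) a)) ∂μ ≤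
      ENNReal.ofReal (2 * Real.exp (κ ^ 2 * ‖a‖ ^ 2 / 4)) := by
  rcases eq_or_ne a 0 with rfl | ha
  · simp
  rw [← mul_pow]
  refine lintegral_exp_le_of_psi2Norm_lt ((h a).2.trans_lt ?_)
  have hn : 0 < ‖a‖ := norm_pos_iff.2 ha
  exact (ENNReal.ofReal_lt_ofReal_iff (mul_pos (hσ.trans_lt hκ) hn)).2 (by gcongr)

lemma IsSubGaussianVec.aemeasurable {Ω : Type*} [MeasurableSpace Ω] {μ : Measure Ω}
    {n : ℕ} {ξ : Ω → EuclideanSpace ℝ (Fin n)} {σ : ℝ} (h : IsSubGaussianVec μ ξ σ) :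
    AEMeasurable ξ μ := by
  have h1 : AEMeasurable (fun ω => (ξ ω).ofLp) μ := by
    refine aemeasurable_pi_iff.2 fun i => ?_
    simpa [EuclideanSpace.inner_single_right] using
      (h (EuclideanSpace.single i 1)).1.1.aestronglyMeasurable.aemeasurable
  exact (WithLp.measurable_toLp 2 (Fin n → ℝ)).comp_aemeasurable h1

/-! ### Strong convexity and the regularity condition -/

/-- First-order characterisation of strong convexity. -/
lemma gbf_ge_of_strongConvexOn {n : ℕ} {f : EuclideanSpace ℝ (Fin n) → ℝ} {m : ℝ}
    (hf : Differentiable ℝ f) (hm : StrongConvexOn Set.univ m f)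
    (a b : EuclideanSpace ℝ (Fin n)) : m * D2 a b ≤ gbf f a b := by
  have hconv := strongConvexOn_iff_convex.1 hm
  set h : EuclideanSpace ℝ (Fin n) → ℝ := fun x => f x - m / (2 : ℝ) * ‖x‖ ^ 2
  -- On the line from b to a, the convex function h has slope over [0, 1] at least its derivative at
  -- 0.
  have hline : ConvexOn ℝ Set.univ (h ∘ AffineMap.lineMap (k := ℝ) b a) := by
    simpa using hconv.comp_affineMap (AffineMap.lineMap (k := ℝ) b a)
  have hγ : HasDerivAt (AffineMap.lineMap (k := ℝ) b a) (a - b) 0 :=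
    AffineMap.hasDerivAt_lineMap
  have hf' : HasDerivAt (f ∘ AffineMap.lineMap (k := ℝ) b a)
      (inner ℝ (gradient f b) (a - b)) 0 := by
    rw [inner_gradient_left]
    have := (hf b).hasFDerivAt
    exact HasFDerivAt.comp_hasDerivAt (0 : ℝ) (by simpa using this) hγ
  have hd : HasDerivAt (h ∘ AffineMap.lineMap (k := ℝ) b a)
      (inner ℝ (gradient f b) (a - b) - m / 2 * (2 * inner ℝ b (a - b))) 0 := by
    have h2 := hγ.norm_sq
    rw [AffineMap.lineMap_apply_zero] at h2
    exact hf'.sub (h2.const_mul (m / 2))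
  have hs := hline.le_slope_of_hasDerivAt (Set.mem_univ 0) (Set.mem_univ 1) zero_lt_one hd
  simp only [slope_def_field, Function.comp_apply, AffineMap.lineMap_apply_one,
    AffineMap.lineMap_apply_zero, sub_zero, div_one, h] at hs
  have e1 : inner ℝ b (a - b) = inner ℝ a b - ‖b‖ ^ 2 := by
    rw [inner_sub_right, real_inner_self_eq_norm_sq, real_inner_comm]
  have e2 := norm_sub_sq_real a b
  rw [D2, gbf, e2]
  rw [e1] at hs
  linarith

lemma regCond_of_strongConvexOn {n p : ℕ} (X : Matrix (Fin n) (Fin p) ℝ)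
    {f : EuclideanSpace ℝ (Fin n) → ℝ} {m : ℝ} (hf : Differentiable ℝ f)
    (hm : StrongConvexOn Set.univ m f) (s o : ℕ) (ϑ : ℝ) : RegCond X f s o ϑ m :=
  fun _ _ _ _ _ _ _ _ => sub_nonneg.2 (gbf_ge_of_strongConvexOn hf hm _ _)

lemma differentiable_half_sq_dist {n : ℕ} (y : EuclideanSpace ℝ (Fin n)) :
    Differentiable ℝ fun η : EuclideanSpace ℝ (Fin n) => ‖η - y‖ ^ 2 / 2 := by
  have : Differentiable ℝ fun η : EuclideanSpace ℝ (Fin n) => ‖η - y‖ ^ 2 :=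
    (differentiable_id.sub_const y).norm_sq ℝ
  simpa only [div_eq_mul_inv] using this.mul_const (2 : ℝ)⁻¹

lemma strongConvexOn_half_sq_dist {n : ℕ} (y : EuclideanSpace ℝ (Fin n)) :
    StrongConvexOn Set.univ 1 fun η : EuclideanSpace ℝ (Fin n) => ‖η - y‖ ^ 2 / 2 := by
  rw [strongConvexOn_iff_convex]
  have e : (fun x : EuclideanSpace ℝ (Fin n) => ‖x - y‖ ^ 2 / 2 - 1 / (2 : ℝ) * ‖x‖ ^ 2) =
      fun x => (innerSL ℝ (-y)).toLinearMap x + ‖y‖ ^ 2 / 2 := by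
    funext x
    have : (innerSL ℝ (-y)).toLinearMap x = -inner ℝ x y := by
      simp [real_inner_comm]
    rw [this, norm_sub_sq_real]
    ring
  rw [e]
  exact (LinearMap.convexOn _ convex_univ).add_const _

/-! ### Supports and column spans -/

/-- The support of a vector. -/
noncomputable def supp {m : ℕ} (v : EuclideanSpace ℝ (Fin m)) : Finset (Fin m) :=
  Finset.univ.filter fun i => v i ≠ 0

lemma card_supp {m : ℕ} (v : EuclideanSpace ℝ (Fin m)) : (supp v).card = l0norm v := by
  rfl

lemma l0norm_le {m : ℕ} (v : EuclideanSpace ℝ (Fin m)) : l0norm v ≤ m :=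
  hammingNorm_le_card_fintype.trans_eq (Fintype.card_fin m)

/-- The span of the columns of `[X I]` indexed by `J` and `I`. -/
noncomputable def colSpan {n p : ℕ} (X : Matrix (Fin n) (Fin p) ℝ) (J : Finset (Fin p)) (I : Finset (Fin n)) :
    Submodule ℝ (EuclideanSpace ℝ (Fin n)) :=
  Submodule.span ℝ ((J.image fun j => WithLp.toLp 2 (Xᵀ j)) ∪
    I.image (fun i => EuclideanSpace.single i (1 : ℝ)) : Finset (EuclideanSpace ℝ (Fin n)))

lemma finrank_colSpan_le {n p : ℕ} (X : Matrix (Fin n) (Fin p) ℝ) (J : Finset (Fin p))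
    (I : Finset (Fin n)) : Module.finrank ℝ (colSpan X J I) ≤ J.card + I.card :=
  (finrank_span_finset_le_card _).trans ((Finset.card_union_le _ _).trans
    (add_le_add Finset.card_image_le Finset.card_image_le))

lemma sysComp_mem_colSpan {n p : ℕ} (X : Matrix (Fin n) (Fin p) ℝ) {J : Finset (Fin p)}
    {I : Finset (Fin n)} {b : EuclideanSpace ℝ (Fin p)} {g : EuclideanSpace ℝ (Fin n)}
    (hb : supp b ⊆ J) (hg : supp g ⊆ I) : sysComp X b g ∈ colSpan X J I := by
  have e1 : WithLp.toLp 2 (X *ᵥ b.ofLp) = ∑ j, b j • WithLp.toLp 2 (Xᵀ j) := by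
    rw [Matrix.mulVec_eq_sum, WithLp.toLp_sum]
    simp
  have e2 : g = ∑ i, g i • EuclideanSpace.single i (1 : ℝ) := by
    ext k
    simp [Finset.sum_apply, Pi.single_apply]
  refine add_mem ?_ ?_
  · rw [e1]
    refine sum_mem fun j _ => ?_
    by_cases hj : b j = 0
    · simp [hj]
    · refine Submodule.smul_mem _ _ (Submodule.subset_span ?_)
      exact Finset.mem_coe.2 (Finset.mem_union_left _ (Finset.mem_image_of_mem _
        (hb (by simpa [supp] using hj))))
  · rw [e2]
    refine sum_mem fun i _ => ?_
    by_cases hi : g i = 0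
    · simp [hi]
    · refine Submodule.smul_mem _ _ (Submodule.subset_span ?_)
      exact Finset.mem_coe.2 (Finset.mem_union_right _ (Finset.mem_image_of_mem _
        (hg (by simpa [supp] using hi))))

lemma sysComp_sub_mem_colSpan {n p : ℕ} (X : Matrix (Fin n) (Fin p) ℝ)
    (b b' : EuclideanSpace ℝ (Fin p)) (g g' : EuclideanSpace ℝ (Fin n)) :
    sysComp X b g - sysComp X b' g' ∈ colSpan X (supp b ∪ supp b') (supp g ∪ supp g') :=
  sub_mem (sysComp_mem_colSpan X Finset.subset_union_left Finset.subset_union_left)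
    (sysComp_mem_colSpan X Finset.subset_union_right Finset.subset_union_right)

lemma aemeasurable_sysComp {Ω : Type*} [MeasurableSpace Ω] {μ : Measure Ω} {n p : ℕ}
    {b : Ω → EuclideanSpace ℝ (Fin p)} {g : Ω → EuclideanSpace ℝ (Fin n)}
    (X : Matrix (Fin n) (Fin p) ℝ) (hb : AEMeasurable b μ) (hg : AEMeasurable g μ) :
    AEMeasurable (fun ω => sysComp X (b ω) (g ω)) μ := by
  have hc : Continuous fun v : EuclideanSpace ℝ (Fin p) => WithLp.toLp 2 (X *ᵥ v.ofLp) := by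
    fun_prop
  exact (hc.measurable.comp_aemeasurable hb).add hg

/-! ### From minimality to projected noise -/

/-- The basic inequality for a global minimizer. -/
lemma IsGlobalMinimizer.mul_D2_le_inner {n p : ℕ} {X : Matrix (Fin n) (Fin p) ℝ}
    {f : EuclideanSpace ℝ (Fin n) → ℝ} {qβ qγ : ℕ} {b b' : EuclideanSpace ℝ (Fin p)}
    {g g' : EuclideanSpace ℝ (Fin n)} {ϑ δ : ℝ} (h : IsGlobalMinimizer X f qβ qγ b g)
    (hϑ : 1 ≤ ϑ) (hβ : (qβ : ℝ) = ϑ * l0norm b') (hγ : (qγ : ℝ) = ϑ * l0norm g')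
    (hreg : RegCond X f (l0norm b') (l0norm g') ϑ δ) :
    δ * D2 (sysComp X b g) (sysComp X b' g') ≤
      inner ℝ (effNoise f (sysComp X b' g')) (sysComp X b g - sysComp X b' g') := by
  have h1 := hreg b b' g g' (by rw [← hβ]; exact_mod_cast h.1.1) le_rfl
    (by rw [← hγ]; exact_mod_cast h.1.2) le_rfl
  have hmem : (b', g') ∈ feasible p n qβ qγ := by
    constructor
    · have : (l0norm b' : ℝ) ≤ qβ := by
        rw [hβ]
        exact le_mul_of_one_le_left (Nat.cast_nonneg _) hϑ
      exact_mod_cast this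
    · have : (l0norm g' : ℝ) ≤ qγ := by
        rw [hγ]
        exact le_mul_of_one_le_left (Nat.cast_nonneg _) hϑ
      exact_mod_cast this
  have h2 : f (sysComp X b g) ≤ f (sysComp X b' g') := h.2 hmem
  rw [gbf] at h1
  rw [effNoise, inner_neg_left]
  linarith

/-- A vector of a subspace is controlled by the projection of the noise onto that subspace. -/
lemma half_sq_norm_le_of_mem {E : Type*} [NormedAddCommGroup E] [InnerProductSpace ℝ E]
    {V : Submodule ℝ E} [V.HasOrthogonalProjection] {w ε : E} {δ : ℝ} (hδ : 0 < δ) (hw : w ∈ V)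
    (h : δ * (‖w‖ ^ 2 / 2) ≤ inner ℝ ε w) :
    ‖w‖ ^ 2 / 2 ≤ 2 / δ ^ 2 * ‖V.orthogonalProjectionOnto ε‖ ^ 2 := by
  have h1 : inner ℝ ε w ≤ ‖V.orthogonalProjectionOnto ε‖ * ‖w‖ := by
    have := V.inner_orthogonalProjectionOnto_eq_of_mem_right ⟨w, hw⟩ ε
    exact this.symm.le.trans (real_inner_le_norm _ _)
  set P := ‖V.orthogonalProjectionOnto ε‖
  rw [div_mul_eq_mul_div, le_div_iff₀ (by positivity)]
  -- From δ‖w‖² ≤ 2P‖w‖, this square yields δ²‖w‖² ≤ 4P² without dividing by ‖w‖.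
  nlinarith [sq_nonneg (δ * ‖w‖ - 2 * P), norm_nonneg w]

/-! ### Union bound and risk bound -/

/-- Union bound for the exponential moments of the projections of a sub-Gaussian vector onto
finitely many subspaces. -/
lemma lintegral_sum_exp_projection_le {Ω : Type*} [MeasurableSpace Ω] {μ : Measure Ω} [SFinite μ]
    {n : ℕ} {ε : Ω → EuclideanSpace ℝ (Fin n)} (hε : AEMeasurable ε μ) {κ : ℝ} (hκ : 0 < κ)
    (hexp : ∀ a, ∫⁻ ω, ENNReal.ofReal (Real.exp (inner ℝ (ε ω) a)) ∂μ ≤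
      ENNReal.ofReal (2 * Real.exp (κ ^ 2 * ‖a‖ ^ 2 / 4)))
    {ι : Type*} (T : Finset ι) (V : ι → Submodule ℝ (EuclideanSpace ℝ (Fin n))) {D : ℕ}
    (hD : ∀ t ∈ T, Module.finrank ℝ (V t) ≤ D) {A : ℝ}
    (hA : (T.card : ℝ) * (2 * 2 ^ (D / 2 : ℝ)) ≤ Real.exp A) :
    ∫⁻ ω, ∑ t ∈ T, ENNReal.ofReal
      (Real.exp (‖(V t).orthogonalProjectionOnto (ε ω)‖ ^ 2 / (2 * κ ^ 2) - A)) ∂μ ≤ 1 := by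
  have hP : ∀ t, AEMeasurable (fun ω => (V t).orthogonalProjectionOnto (ε ω)) μ := fun t =>
    (V t).orthogonalProjectionOnto.continuous.measurable.comp_aemeasurable hε
  have hterm : ∀ t ∈ T, ∫⁻ ω, ENNReal.ofReal
      (Real.exp (‖(V t).orthogonalProjectionOnto (ε ω)‖ ^ 2 / (2 * κ ^ 2) - A)) ∂μ ≤
      ENNReal.ofReal (2 * 2 ^ (D / 2 : ℝ) * Real.exp (-A)) := by
    intro t ht
    simp_rw [sub_eq_add_neg, Real.exp_add, ENNReal.ofReal_mul (Real.exp_pos _).le]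
    rw [lintegral_mul_const' _ _ ENNReal.ofReal_ne_top, ENNReal.ofReal_mul (by positivity)]
    gcongr
    refine (lintegral_exp_sq_norm_le (hP t) hκ fun v => ?_).trans (ENNReal.ofReal_le_ofReal ?_)
    -- For v in the subspace, ⟨Pε, v⟩ = ⟨ε, v⟩, so the projection inherits the bound with the same
    -- κ.
    · simp_rw [Submodule.inner_orthogonalProjectionOnto_eq_of_mem_right]
      exact hexp v
    · have := hD t ht
      gcongr
      norm_num
  have hmeas : ∀ t ∈ T, AEMeasurable (fun ω => ENNReal.ofReal
      (Real.exp (‖(V t).orthogonalProjectionOnto (ε ω)‖ ^ 2 / (2 * κ ^ 2) - A))) μ := fun t _ =>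
    (Real.measurable_exp.comp_aemeasurable
      ((((hP t).norm.pow_const 2).div_const _).sub_const A)).ennreal_ofReal
  rw [lintegral_finsetSum' _ hmeas]
  calc ∑ t ∈ T, ∫⁻ ω, ENNReal.ofReal
        (Real.exp (‖(V t).orthogonalProjectionOnto (ε ω)‖ ^ 2 / (2 * κ ^ 2) - A)) ∂μ
      ≤ ∑ _t ∈ T, ENNReal.ofReal (2 * 2 ^ (D / 2 : ℝ) * Real.exp (-A)) := Finset.sum_le_sum hterm
    _ = ENNReal.ofReal (T.card * (2 * 2 ^ (D / 2 : ℝ)) * Real.exp (-A)) := by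
        rw [Finset.sum_const, nsmul_eq_mul, mul_assoc (T.card : ℝ), ENNReal.ofReal_mul (Nat.cast_nonneg _),
          ENNReal.ofReal_natCast]
    _ ≤ ENNReal.ofReal (Real.exp A * Real.exp (-A)) := by gcongr
    _ = 1 := by rw [← Real.exp_add, add_neg_cancel, Real.exp_zero, ENNReal.ofReal_one]

lemma complexity_nonneg {p n s o : ℕ} (hs : s ≤ p) (ho : o ≤ n) : 0 ≤ complexity p n s o :=
  add_nonneg ((Nat.cast_nonneg s).trans (natCast_le_mul_log hs))
    ((Nat.cast_nonneg o).trans (natCast_le_mul_log ho))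

/-- The pairs of supports of size at most `(qβ, qγ)`. -/
def supportPairs (p n qβ qγ : ℕ) : Finset (Finset (Fin p) × Finset (Fin n)) :=
  (Finset.univ.filter fun T : Finset (Fin p) => T.card ≤ qβ) ×ˢ
    (Finset.univ.filter fun T : Finset (Fin n) => T.card ≤ qγ)

/-- The counts contribute ϑQ, Q being the complexity; the dimension gives (ϑ + 1)(s + o)/2 ≤ ϑ(s +
o) ≤ ϑQ; the factor 2 ≤ e gives the final 1. -/
lemma card_supportPairs_mul_le {p n s o qβ qγ : ℕ} {ϑ : ℝ} (hs : s ≤ p) (ho : o ≤ n)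
    (hϑ : 1 ≤ ϑ) (hβ : (qβ : ℝ) = ϑ * s) (hγ : (qγ : ℝ) = ϑ * o) :
    ((supportPairs p n qβ qγ).card : ℝ) *
        (2 * 2 ^ (((qβ + s + (qγ + o) : ℕ) : ℝ) / 2)) ≤
      Real.exp (2 * ϑ * complexity p n s o + 1) := by
  have hsβ : s ≤ qβ := by
    have : (s : ℝ) ≤ qβ := hβ ▸ le_mul_of_one_le_left (Nat.cast_nonneg _) hϑ
    exact_mod_cast this
  have hoγ : o ≤ qγ := by
    have : (o : ℝ) ≤ qγ := hγ ▸ le_mul_of_one_le_left (Nat.cast_nonneg _) hϑ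
    exact_mod_cast this
  have h1 := card_filter_card_le hs hsβ fun h => by
    rw [h, Nat.cast_zero, mul_zero] at hβ
    exact_mod_cast hβ
  have h2 := card_filter_card_le ho hoγ fun h => by
    rw [h, Nat.cast_zero, mul_zero] at hγ
    exact_mod_cast hγ
  have h3 : (2 : ℝ) ≤ Real.exp 1 := by
    have := Real.add_one_le_exp 1
    linarith
  have h4 : (2 : ℝ) ^ (((qβ + s + (qγ + o) : ℕ) : ℝ) / 2) ≤
      Real.exp (((qβ + s + (qγ + o) : ℕ) : ℝ) / 2) := by
    rw [← Real.exp_one_rpow]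
    exact Real.rpow_le_rpow zero_le_two h3 (by positivity)
  have h5 := natCast_le_mul_log hs
  have h6 := natCast_le_mul_log ho
  rw [supportPairs, Finset.card_product, Nat.cast_mul]
  calc _ ≤ Real.exp (qβ * Real.log (Real.exp 1 * p / s)) *
        Real.exp (qγ * Real.log (Real.exp 1 * n / o)) *
        (Real.exp 1 * Real.exp (((qβ + s + (qγ + o) : ℕ) : ℝ) / 2)) := by gcongr
    _ = Real.exp (qβ * Real.log (Real.exp 1 * p / s) + qγ * Real.log (Real.exp 1 * n / o) +
        (1 + ((qβ + s + (qγ + o) : ℕ) : ℝ) / 2)) := by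
        simp only [Real.exp_add]
    _ ≤ _ := by
        refine Real.exp_le_exp.2 ?_
        push_cast
        have hϑ0 : 0 ≤ ϑ := zero_le_one.trans hϑ
        rw [hβ, hγ, complexity]
        have h7 := mul_le_mul_of_nonneg_left h5 hϑ0
        have h8 := mul_le_mul_of_nonneg_left h6 hϑ0
        have h9 : (s : ℝ) ≤ ϑ * s := le_mul_of_one_le_left (Nat.cast_nonneg _) hϑ
        have h10 : (o : ℝ) ≤ ϑ * o := le_mul_of_one_le_left (Nat.cast_nonneg _) hϑ
        linarith

lemma integral_D2_le {n p : ℕ} {X : Matrix (Fin n) (Fin p) ℝ} {𝒴 : Type*}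
    {l : EuclideanSpace ℝ (Fin n) → 𝒴 → ℝ} {Ω : Type*} [MeasurableSpace Ω] {μ : Measure Ω}
    [IsProbabilityMeasure μ] {y : Ω → 𝒴} {βs : EuclideanSpace ℝ (Fin p)}
    {γs : EuclideanSpace ℝ (Fin n)} {σ : ℝ} (hσ : 0 ≤ σ)
    (hε : IsSubGaussianVec μ (fun ω => effNoise (fun η => l η (y ω)) (sysComp X βs γs)) σ)
    {ϑ : ℝ} (hϑ : 1 ≤ ϑ) {qβ qγ : ℕ} (hβ : (qβ : ℝ) = ϑ * l0norm βs)
    (hγ : (qγ : ℝ) = ϑ * l0norm γs) {βh : Ω → EuclideanSpace ℝ (Fin p)}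
    {γh : Ω → EuclideanSpace ℝ (Fin n)} (hβh : AEMeasurable βh μ) (hγh : AEMeasurable γh μ)
    (hmin : ∀ᵐ ω ∂μ, IsGlobalMinimizer X (fun η => l η (y ω)) qβ qγ (βh ω) (γh ω))
    {δ : ℝ} (hδ : 0 < δ)
    (hreg : ∀ᵐ ω ∂μ, RegCond X (fun η => l η (y ω)) (l0norm βs) (l0norm γs) ϑ δ) :
    Integrable (fun ω => D2 (sysComp X (βh ω) (γh ω)) (sysComp X βs γs)) μ ∧
      ∫ ω, D2 (sysComp X (βh ω) (γh ω)) (sysComp X βs γs) ∂μ ≤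
        8 * (ϑ / δ ^ 2 * σ ^ 2 * complexity p n (l0norm βs) (l0norm γs) + σ ^ 2 / δ ^ 2) := by
  set Z : Ω → ℝ := fun ω => D2 (sysComp X (βh ω) (γh ω)) (sysComp X βs γs)
  set Q := complexity p n (l0norm βs) (l0norm γs)
  have hQ : 0 ≤ Q := complexity_nonneg (l0norm_le βs) (l0norm_le γs)
  have hZ0 : ∀ ω, 0 ≤ Z ω := fun ω => by
    simp only [Z, D2]
    positivity
  have hZm : AEMeasurable Z μ := by
    have h1 : AEMeasurable (fun ω => sysComp X (βh ω) (γh ω)) μ :=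
      aemeasurable_sysComp X hβh hγh
    exact ((h1.sub_const _).norm.pow_const 2).div_const 2
  have hbound : ∀ κ, σ < κ →
      ∫⁻ ω, ENNReal.ofReal (Z ω) ∂μ ≤ ENNReal.ofReal (4 * κ ^ 2 / δ ^ 2 * (2 * ϑ * Q + 1 + 1)) := by
    intro κ hκ
    have hκ0 : 0 < κ := hσ.trans_lt hκ
    have hc0 : 0 ≤ 4 * κ ^ 2 / δ ^ 2 := by positivity
    set A : ℝ := 2 * ϑ * Q + 1 with hAdef
    have hA0 : 0 ≤ A := by positivity
    set ε : Ω → EuclideanSpace ℝ (Fin n) :=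
      fun ω => effNoise (fun η => l η (y ω)) (sysComp X βs γs)
    set T := supportPairs p n qβ qγ
    set V : Finset (Fin p) × Finset (Fin n) → Submodule ℝ (EuclideanSpace ℝ (Fin n)) :=
      fun t => colSpan X (t.1 ∪ supp βs) (t.2 ∪ supp γs)
    have hsum := lintegral_sum_exp_projection_le hε.aemeasurable hκ0
      (fun a => hε.lintegral_exp_inner_le hσ hκ a) T V
      (D := qβ + l0norm βs + (qγ + l0norm γs)) (A := A) (by
        intro t ht
        have ht' := Finset.mem_product.1 ht
        have ht1 := (Finset.mem_filter.1 ht'.1).2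
        have ht2 := (Finset.mem_filter.1 ht'.2).2
        refine (finrank_colSpan_le X _ _).trans (add_le_add ?_ ?_)
        · exact (Finset.card_union_le _ _).trans (add_le_add ht1 (card_supp βs).le)
        · exact (Finset.card_union_le _ _).trans (add_le_add ht2 (card_supp γs).le))
      (card_supportPairs_mul_le (l0norm_le βs) (l0norm_le γs) hϑ hβ hγ)
    set G : Finset (Fin p) × Finset (Fin n) → Ω → ℝ := fun t ω =>
      ‖(V t).orthogonalProjectionOnto (ε ω)‖ ^ 2 / (2 * κ ^ 2)
    have hpt : ∀ᵐ ω ∂μ, ENNReal.ofReal (Z ω) ≤ ENNReal.ofReal (4 * κ ^ 2 / δ ^ 2) *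
        (ENNReal.ofReal A + ∑ t ∈ T, ENNReal.ofReal (Real.exp (G t ω - A))) := by
      filter_upwards [hmin, hreg] with ω h1 h2
      have ht : (supp (βh ω), supp (γh ω)) ∈ T := by
        simp only [T, supportPairs, Finset.mem_product, Finset.mem_filter, Finset.mem_univ,
          true_and, card_supp]
        exact h1.1
      have h3 := half_sq_norm_le_of_mem hδ (sysComp_sub_mem_colSpan X (βh ω) βs (γh ω) γs)
        (h1.mul_D2_le_inner hϑ hβ hγ h2)
      -- The factor 4κ²/δ² is 2/δ² times the 2κ² normalising G.
      have h4 : Z ω ≤ 4 * κ ^ 2 / δ ^ 2 * G (supp (βh ω), supp (γh ω)) ω := by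
        refine h3.trans_eq ?_
        simp only [G, V, ε]
        field_simp
        ring
      -- This linear-plus-exponential bound allows the random support to be replaced by a sum over
      -- all of T.
      have h5 : G (supp (βh ω), supp (γh ω)) ω ≤
          A + Real.exp (G (supp (βh ω), supp (γh ω)) ω - A) := by
        have := Real.add_one_le_exp (G (supp (βh ω), supp (γh ω)) ω - A)
        linarith
      calc ENNReal.ofReal (Z ω)
          ≤ ENNReal.ofReal (4 * κ ^ 2 / δ ^ 2 *
              (A + Real.exp (G (supp (βh ω), supp (γh ω)) ω - A))) :=
            ENNReal.ofReal_le_ofReal (h4.trans (mul_le_mul_of_nonneg_left h5 hc0))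
        _ = ENNReal.ofReal (4 * κ ^ 2 / δ ^ 2) * (ENNReal.ofReal A +
              ENNReal.ofReal (Real.exp (G (supp (βh ω), supp (γh ω)) ω - A))) := by
            rw [ENNReal.ofReal_mul hc0, ENNReal.ofReal_add hA0 (Real.exp_pos _).le]
        _ ≤ _ := by
            gcongr
            exact Finset.single_le_sum
              (f := fun t => ENNReal.ofReal (Real.exp (G t ω - A))) (fun _ _ => zero_le) ht
    calc ∫⁻ ω, ENNReal.ofReal (Z ω) ∂μ
        ≤ ∫⁻ ω, ENNReal.ofReal (4 * κ ^ 2 / δ ^ 2) *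
            (ENNReal.ofReal A + ∑ t ∈ T, ENNReal.ofReal (Real.exp (G t ω - A))) ∂μ :=
          lintegral_mono_ae hpt
      _ = ENNReal.ofReal (4 * κ ^ 2 / δ ^ 2) * (ENNReal.ofReal A +
            ∫⁻ ω, ∑ t ∈ T, ENNReal.ofReal (Real.exp (G t ω - A)) ∂μ) := by
          rw [lintegral_const_mul' _ _ ENNReal.ofReal_ne_top, lintegral_add_left measurable_const,
            lintegral_const, measure_univ, mul_one]
      _ ≤ ENNReal.ofReal (4 * κ ^ 2 / δ ^ 2) * (ENNReal.ofReal A + ENNReal.ofReal 1) := by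
          rw [ENNReal.ofReal_one]
          gcongr
      _ = ENNReal.ofReal (4 * κ ^ 2 / δ ^ 2 * (A + 1)) := by
          rw [ENNReal.ofReal_mul hc0, ENNReal.ofReal_add hA0 zero_le_one]
  have hint : Integrable Z μ := by
    refine ⟨hZm.aestronglyMeasurable, ?_⟩
    rw [hasFiniteIntegral_iff_ofReal (Filter.Eventually.of_forall hZ0)]
    exact (hbound (σ + 1) (lt_add_one σ)).trans_lt ENNReal.ofReal_lt_top
  refine ⟨hint, ?_⟩
  have hreal : ∀ κ, σ < κ → ∫ ω, Z ω ∂μ ≤ 4 * κ ^ 2 / δ ^ 2 * (2 * ϑ * Q + 1 + 1) := by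
    intro κ hκ
    have := hbound κ hκ
    rw [← ofReal_integral_eq_lintegral_ofReal hint (Filter.Eventually.of_forall hZ0)] at this
    exact (ENNReal.ofReal_le_ofReal_iff (by positivity)).1 this
  -- Letting κ ↓ σ restores σ itself; 4(2ϑQ + 2) = 8(ϑQ + 1) gives the constant 8.
  have hlim : Filter.Tendsto (fun κ : ℝ => 4 * κ ^ 2 / δ ^ 2 * (2 * ϑ * Q + 1 + 1))
      (nhdsWithin σ (Set.Ioi σ)) (nhds (4 * σ ^ 2 / δ ^ 2 * (2 * ϑ * Q + 1 + 1))) := by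
    have : Continuous fun κ : ℝ => 4 * κ ^ 2 / δ ^ 2 * (2 * ϑ * Q + 1 + 1) := by fun_prop
    exact (this.tendsto σ).mono_left nhdsWithin_le_nhds
  refine (ge_of_tendsto hlim (Filter.eventually_of_mem self_mem_nhdsWithin hreal)).trans_eq ?_
  ring

end ResistantLearning

theorem theoremA2 :
    -- the error bound, with a universal constant `C`
    (∃ C : ℝ, 0 < C ∧
      ∀ (n p : ℕ) (X : Matrix (Fin n) (Fin p) ℝ)
        -- the response `y` takes values in an arbitrary response space
        (𝒴 : Type*) (l : EuclideanSpace ℝ (Fin n) → 𝒴 → ℝ)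
        (_ : ∀ y : 𝒴, Differentiable ℝ (fun η => l η y))
        (Ω : Type*) [MeasurableSpace Ω] (μ : Measure Ω) [IsProbabilityMeasure μ]
        (y : Ω → 𝒴)
        -- the statistical truth and its effective noise
        (βs : EuclideanSpace ℝ (Fin p)) (γs : EuclideanSpace ℝ (Fin n))
        (σ : ℝ) (_ : 0 ≤ σ)
        (_ : ResistantLearning.IsSubGaussianVec μ
          (fun ω => ResistantLearning.effNoise (fun η => l η (y ω))
            (ResistantLearning.sysComp X βs γs)) σ)
        -- the sparsity levels
        (ϑ : ℝ) (_ : 1 ≤ ϑ) (qβ qγ : ℕ)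
        (_ : (qβ : ℝ) = ϑ * ResistantLearning.l0norm βs)
        (_ : (qγ : ℝ) = ϑ * ResistantLearning.l0norm γs)
        -- the estimator
        (βh : Ω → EuclideanSpace ℝ (Fin p)) (γh : Ω → EuclideanSpace ℝ (Fin n))
        (_ : AEMeasurable βh μ) (_ : AEMeasurable γh μ)
        (_ : ∀ᵐ ω ∂μ, ResistantLearning.IsGlobalMinimizer X (fun η => l η (y ω)) qβ qγ
          (βh ω) (γh ω))
        -- the regularity condition
        (δ : ℝ) (_ : 0 < δ)
        (_ : ∀ᵐ ω ∂μ, ResistantLearning.RegCond X (fun η => l η (y ω))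
          (ResistantLearning.l0norm βs) (ResistantLearning.l0norm γs) ϑ δ),
        Integrable (fun ω => ResistantLearning.D2
          (ResistantLearning.sysComp X (βh ω) (γh ω))
          (ResistantLearning.sysComp X βs γs)) μ ∧
        ∫ ω, ResistantLearning.D2
          (ResistantLearning.sysComp X (βh ω) (γh ω))
          (ResistantLearning.sysComp X βs γs) ∂μ
          ≤ C * (ϑ / δ ^ 2 * σ ^ 2 * ResistantLearning.complexity p n
              (ResistantLearning.l0norm βs) (ResistantLearning.l0norm γs)
            + σ ^ 2 / δ ^ 2)) ∧
    -- the regularity condition holds with `δ = m` for every differentiable `m`-strongly convex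
    -- loss, whatever the design and the sparsity levels
    (∀ (n p : ℕ) (X : Matrix (Fin n) (Fin p) ℝ) (f : EuclideanSpace ℝ (Fin n) → ℝ) (m : ℝ),
      0 < m → Differentiable ℝ f → StrongConvexOn Set.univ m f →
      ∀ (s o : ℕ) (ϑ : ℝ), ResistantLearning.RegCond X f s o ϑ m) ∧
    -- in particular, with `δ = 1` for the squared error loss
    (∀ (n p : ℕ) (X : Matrix (Fin n) (Fin p) ℝ) (y : EuclideanSpace ℝ (Fin n))
      (s o : ℕ) (ϑ : ℝ),
      ResistantLearning.RegCond X (fun η => ‖η - y‖ ^ 2 / 2) s o ϑ 1) := by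
  refine ⟨⟨8, by norm_num, ?_⟩, ?_, ?_⟩
  · intro n p X 𝒴 l _ Ω _ μ _ y βs γs σ hσ hε ϑ hϑ qβ qγ hβ hγ βh γh hβh hγh hmin δ hδ hreg
    exact ResistantLearning.integral_D2_le hσ hε hϑ hβ hγ hβh hγh hmin hδ hreg
  · intro n p X f m _ hf hm s o ϑ
    exact ResistantLearning.regCond_of_strongConvexOn X hf hm s o ϑ
  · intro n p X y s o ϑ
    exact ResistantLearning.regCond_of_strongConvexOn X
      (ResistantLearning.differentiable_half_sq_dist y)
      (ResistantLearning.strongConvexOn_half_sq_dist y) s o ϑ
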